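/- Fix a real number $\rho > 0$ and integers $N \geq 1$, $M \geq 0$, and let $$f(z) := \sum_{j=0}^{N-1} c_j z^j + c' z^M$$ be a polynomial with real $c_0, \ldots, c_{N-1}, c'$. Let $\overline{D}(0,\rho)$ denote the closed complex disc of radius $\rho$ centered at the origin. For $I \subset \mathbb{C}$ and $1 \leq k \leq N$, let $\mathcal{P}_N^k(I)$ denote the set of complex (Hermitian) positive semidefinite $N \times N$ matrices with all entries in $I$ and rank at most $k$, and let $\mathcal{P}_N(I) := \mathcal{P}_N^N(I)$. Say that $f[-]$ preserves positivity on a set $\mathcal{P}$ of matrices if $f[A] := (f(a_{jk}))_{j,k}$ is positive semidefinite for every $A = (a_{jk}) \in \mathcal{P}$. Then the following are equivalent. 1. $f[-]$ preserves positivity on $\mathcal{P}_N(\overline{D}(0,\rho))$. 2. Either all the coefficients of the polynomial $f$ are non-negative (that is, $c_0, \ldots, c_{N-1}, c' \geq 0$ if $M \geq N$; and $c_M + c' \geq 0$ and $c_j \geq 0$ for all $0 \leq j < N$ with $j \neq M$, if $M < N$), or $c_0, \ldots, c_{N-1} > 0$ and $c' \geq -\mathcal{C}^{-1}$, where $$\mathcal{C}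 := \sum_{j=0}^{N-1} \binom{M}{j}^2 \binom{M-j-1}{N-j-1}^2 \frac{\rho^{M-j}}{c_j}.$$ Here $\binom{x}{k} := x(x-1)\cdots(x-k+1)/k!$ for integers $x$ and $k \geq 0$ (so that $\mathcal{C} = c_M^{-1}$ if $M < N$). 3. $f[-]$ preserves positivity on $\mathcal{P}_N^1((0,\rho))$, that is, on the real positive semidefinite $N \times N$ matrices of rank one with all entries in $(0,\rho)$. -/

import Mathlib

open scoped ComplexOrder

noncomputable section

/-- The set of complex positive semidefinite `N × N` matrices with all entries in `I` and
rank at most `k`. -/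
def PSDMatrices (N k : ℕ) (I : Set ℂ) : Set (Matrix (Fin N) (Fin N) ℂ) :=
  {A | A.PosSemidef ∧ (∀ i j, A i j ∈ I) ∧ A.rank ≤ k}

/-- The entrywise map `A ↦ f[A] = (f (a i j))` sends every matrix in `S` to a positive
semidefinite matrix. -/
def PreservesPositivity {N : ℕ} (f : ℂ → ℂ) (S : Set (Matrix (Fin N) (Fin N) ℂ)) : Prop :=
  ∀ A ∈ S, (A.map f).PosSemidef

/-- The polynomial `c 0 + c 1 * z + ⋯ + c (N - 1) * z ^ (N - 1) + c' * z ^ M`.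
If `M < N`, its coefficient of `z ^ M` is `c M + c'`. -/
def perturbedPoly {N : ℕ} (c : Fin N → ℝ) (M : ℕ) (c' : ℝ) : Polynomial ℝ :=
  ∑ j : Fin N, Polynomial.C (c j) * Polynomial.X ^ (j : ℕ) + Polynomial.C c' * Polynomial.X ^ M

/-- The constant
`∑ j < N, binom(M, j)² * binom(M - j - 1, N - j - 1)² * ρ ^ (M - j) / c j`.
The upper index `M - j - 1` may be negative (when `M < N`), so the second factor is the
generalized binomial coefficient of the integer `M - j - 1`; in the first factor `0 ≤ M`,
and it is `0` when `M < j`. -/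
def thresholdConst {N : ℕ} (c : Fin N → ℝ) (M : ℕ) (ρ : ℝ) : ℝ :=
  ∑ j : Fin N, (M.choose j : ℝ) ^ 2 *
    ((Ring.choose ((M : ℤ) - (j : ℕ) - 1) (N - j - 1) : ℤ) : ℝ) ^ 2 *
      (ρ ^ ((M : ℤ) - (j : ℕ)) / c j)

end

/-!
Write `L k = ∑ i, conj (x i) * ζ i ^ k` (`powerMoment`). The quadratic form of `f[ζ ζ*]` at `x` is
`∑ j < N, c j * |L j| ^ 2 + c' * |L M| ^ 2`. Suppose `N ≤ M`. If `w j` are the coefficients of the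
remainder of `X ^ M` modulo `∏ i, (X - ζ i)`, then `L M = ∑ j, w j * L j`, since the two polynomials
agree at the nodes. Thus everything is governed by the size of `∑ j, |w j| ^ 2 / c j`, by
Cauchy–Schwarz.

The coefficients `w j` are, up to a sign depending only on `j` and `N`, polynomials in the nodes with
non-negative coefficients (they are Schur polynomials of hook shape). This is visible from the
recursion defining `powRemainder`. Hence `|w j|` is largest, for nodes in the disc of radius `√ρ`,
when all nodes are equal to `√ρ`, and there it is `binom(M, j) * binom(M - j - 1, N - j - 1) *
√ρ ^ (M - j)`; so the supremum of `∑ j, |w j| ^ 2 / c j` is the threshold constant. This gives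
sufficiency of the threshold for matrices of rank one (`posSemidef_map_aeval_vecMulVec`).

General matrices are reached by induction on `N` (`posSemidef_map_aeval_of_threshold`): subtract
from `A` a matrix `ζ ζ*` of rank one with the same row and column of index `0`, and move along the
segment from `ζ ζ*` to `A`. The derivative of `f[-]` there is the Schur product of `A - ζ ζ*`, an
`(N - 1) × (N - 1)` matrix bordered by zeros, with the entrywise image under `f'`, which is again of
the perturbed form with `N - 1` in place of `N`, and satisfies the threshold
(`mul_thresholdConst_le`).

Conversely, for distinct positive nodes the moments `L j`, `j < N`, can be prescribed, so that
positivity on matrices of rank one yields `0 ≤ ∑ j, c j * |t j| ^ 2 + c' * |∑ j, w j * t j| ^ 2` for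
all `t`, also in the limit of coinciding nodes (`interpCoeff_const_form_nonneg`). Suitable choices of
`t` give the sign conditions and the threshold (`condition_of_preserves_rank_one`).

If `M < N`, the second alternative of the condition only says that the coefficients of `f` are
non-negative, which suffices by the Schur product theorem.
-/

/-! ### Remainders of monomials -/

open Polynomial in
/-- The remainder of `X ^ M` modulo `∏ (X - a)`, the product over the `N` entries `a` of the list,
for `M + 1 = N + d`; it is `0` for the empty list. The indexing by `d` starts the recursion at
`M = N - 1`, where the remainder is the monomial `X ^ (N - 1)` itself, and avoids negative
exponents. The recursion is `X ^ (M + 1) = a * X ^ M + (X - a) * X ^ M`, in which the second summand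
only needs `X ^ M` modulo the product over the remaining nodes. -/
noncomputable def powRemainder {R : Type*} [CommRing R] : List R → ℕ → Polynomial R
  | [], _ => 0
  | _ :: l, 0 => X ^ l.length
  | a :: l, d + 1 => C a * powRemainder (a :: l) d + (X - C a) * powRemainder l (d + 1)

theorem powRemainder_coeff_succ_zero {R : Type*} [CommRing R] (a : R) (l : List R) (d : ℕ) :
    (powRemainder (a :: l) (d + 1)).coeff 0 =
      a * (powRemainder (a :: l) d).coeff 0 - a * (powRemainder l (d + 1)).coeff 0 := by
  rw [powRemainder]
  simp [sub_mul]
  ring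

theorem powRemainder_coeff_succ_succ {R : Type*} [CommRing R] (a : R) (l : List R) (d j : ℕ) :
    (powRemainder (a :: l) (d + 1)).coeff (j + 1) =
      a * (powRemainder (a :: l) d).coeff (j + 1) + (powRemainder l (d + 1)).coeff j
        - a * (powRemainder l (d + 1)).coeff (j + 1) := by
  rw [powRemainder]
  simp [sub_mul]
  ring

/-- `powRemainder` interpolates `X ^ M` at the nodes; repeated nodes are allowed. -/
theorem eval_powRemainder {R : Type*} [CommRing R] {x : R} : ∀ (a : R) (l : List R) (d : ℕ),
    x ∈ a :: l → (powRemainder (a :: l) d).eval x = x ^ (l.length + d)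
  | a, l, 0, _ => by simp [powRemainder]
  | a, l, d + 1, hx => by
    rw [powRemainder]
    simp only [Polynomial.eval_add, Polynomial.eval_mul, Polynomial.eval_C, Polynomial.eval_sub,
      Polynomial.eval_X]
    rw [eval_powRemainder a l d hx]
    rcases List.mem_cons.1 hx with rfl | h
    · ring
    · cases l with
      | nil => simp at h
      | cons b l =>
        rw [eval_powRemainder b l (d + 1) h, List.length_cons]
        ring

/-- The integer `binom(M, j) * binom(M - j - 1, N - j - 1)` for `j < N`, and `0` for `N ≤ j`: the
absolute value of the coefficient of `X ^ j` in the remainder of `X ^ M` modulo `(X - 1) ^ N`, for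
`N ≤ M + 1`. (It counts the semistandard tableaux of hook shape `(M - N + 1, 1 ^ (N - j - 1))`.)
The only truncated subtraction is at `M + 1 = N`, `j = M`, where the second factor is
`binom(0, 0) = 1`, as it should be. -/
def hookCount (N M j : ℕ) : ℕ :=
  if j < N then M.choose j * (M - j - 1).choose (N - j - 1) else 0

theorem hookCount_of_le {N M j : ℕ} (h : N ≤ j) : hookCount N M j = 0 := if_neg (by omega)

theorem hookCount_succ_self (n j : ℕ) : hookCount (n + 1) n j = if j = n then 1 else 0 := by
  unfold hookCount
  split_ifs with h1 h2 h2
  · subst h2; simp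
  · rw [Nat.choose_eq_zero_of_lt (show n - j - 1 < n + 1 - j - 1 by omega), mul_zero]
  · omega
  · rfl

theorem hookCount_zero_right {N M : ℕ} (h : N ≤ M) :
    hookCount (N + 1) (M + 1) 0 = hookCount (N + 1) M 0 + hookCount N M 0 := by
  rcases N with _ | N
  · simp [hookCount]
  · obtain ⟨e, rfl⟩ := Nat.exists_eq_add_of_le h
    simp only [hookCount, Nat.succ_pos, if_true, Nat.choose_zero_right, one_mul, Nat.sub_zero,
      Nat.add_sub_cancel]
    rw [show N + 1 + e - 1 = N + e by omega, show N + 1 + e = (N + e) + 1 by omega,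
      Nat.choose_succ_succ]
    ring

/-- Pascal-type recursion, matching `powRemainder_coeff_succ_succ`. -/
theorem hookCount_succ_succ {N M : ℕ} (h : N ≤ M) (j : ℕ) :
    hookCount (N + 1) (M + 1) (j + 1) =
      hookCount (N + 1) M (j + 1) + hookCount N M j + hookCount N M (j + 1) := by
  unfold hookCount
  rcases lt_trichotomy (j + 1) N with hj | hj | hj
  · obtain ⟨k, rfl⟩ := Nat.exists_eq_add_of_le (show j + 2 ≤ N by omega)
    obtain ⟨e, rfl⟩ := Nat.exists_eq_add_of_le h
    rw [if_pos (by omega), if_pos (by omega), if_pos (by omega), if_pos (by omega)]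
    rw [show j + 2 + k + e + 1 - (j + 1) - 1 = (k + e) + 1 by omega,
      show j + 2 + k + 1 - (j + 1) - 1 = k + 1 by omega,
      show j + 2 + k + e - (j + 1) - 1 = k + e by omega,
      show j + 2 + k + e - j - 1 = (k + e) + 1 by omega,
      show j + 2 + k - j - 1 = k + 1 by omega,
      show j + 2 + k - (j + 1) - 1 = k by omega,
      Nat.choose_succ_succ (j + 2 + k + e) j, Nat.choose_succ_succ (k + e) k]
    ring
  · subst hj
    simp only [lt_add_iff_pos_right, zero_lt_one, if_true, lt_irrefl, if_false]
    rw [show j + 1 + 1 - (j + 1) - 1 = 0 by omega, show j + 1 - j - 1 = 0 by omega]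
    simp [Nat.choose_succ_succ, add_comm]
  · rw [if_neg (by omega), if_neg (by omega), if_neg (by omega), if_neg (by omega)]

theorem succ_mul_hookCount_succ (N M j : ℕ) :
    (j + 1) * hookCount (N + 1) (M + 1) (j + 1) = (M + 1) * hookCount N M j := by
  unfold hookCount
  by_cases h : j < N
  · rw [if_pos (by omega), if_pos h, Nat.add_sub_add_right, Nat.add_sub_add_right, ← mul_assoc,
      ← mul_assoc, Nat.add_one_mul_choose_eq, mul_comm (j + 1)]
  · rw [if_neg (by omega), if_neg h, mul_zero, mul_zero]

theorem hookCount_mul_pow {R : Type*} [CommSemiring R] {N M : ℕ} (h : N ≤ M + 1) (j : ℕ) (a : R) :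
    (hookCount N M j : R) * a ^ (M + 1 - j) = hookCount N M j * (a * a ^ (M - j)) := by
  by_cases hj : j < N
  · rw [show M + 1 - j = (M - j) + 1 by omega, pow_succ']
  · simp [hookCount_of_le (not_lt.1 hj)]

theorem powRemainder_coeff_of_le {R : Type*} [CommRing R] : ∀ (l : List R) (d : ℕ) {j : ℕ},
    l.length ≤ j → (powRemainder l d).coeff j = 0
  | [], d, j, _ => by simp [powRemainder]
  | a :: l, 0, j, h => by
    rw [powRemainder, Polynomial.coeff_X_pow, if_neg]
    rw [List.length_cons] at h
    omega
  | a :: l, d + 1, j, h => by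
    rw [List.length_cons] at h
    obtain ⟨j, rfl⟩ := Nat.exists_eq_succ_of_ne_zero (show j ≠ 0 by omega)
    rw [powRemainder_coeff_succ_succ, powRemainder_coeff_of_le (a :: l) d (by simpa using h),
      powRemainder_coeff_of_le l (d + 1) (by omega), powRemainder_coeff_of_le l (d + 1) (by omega)]
    simp

/-- Up to the sign `(-1) ^ (N + 1 + j)`, the coefficients of the remainder are polynomials in the
nodes with non-negative coefficients, so they are largest when all nodes are equal to `r`. -/
theorem norm_coeff_powRemainder_le {r : ℝ} (hr : 0 ≤ r) : ∀ (l : List ℂ) (d : ℕ) (j : ℕ),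
    (∀ a ∈ l, ‖a‖ ≤ r) → ‖(powRemainder l d).coeff j‖ ≤
      hookCount l.length (l.length + d - 1) j * r ^ (l.length + d - 1 - j)
  | [], d, j, _ => by simp [powRemainder, hookCount]
  | a :: l, 0, j, _ => by
    rw [powRemainder, Polynomial.coeff_X_pow, List.length_cons, Nat.add_zero, Nat.add_sub_cancel,
      hookCount_succ_self]
    split_ifs with h
    · simp [h]
    · simp
  | a :: l, d + 1, j, h => by
    have ha : ‖a‖ ≤ r := h a (by simp)
    have h1 := fun j => norm_coeff_powRemainder_le hr (a :: l) d j h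
    have h2 := fun j => norm_coeff_powRemainder_le hr l (d + 1) j
      (fun b hb => h b (List.mem_cons_of_mem _ hb))
    simp only [List.length_cons, show l.length + 1 + d - 1 = l.length + d by omega,
      show l.length + (d + 1) - 1 = l.length + d by omega,
      show l.length + 1 + (d + 1) - 1 = l.length + d + 1 by omega] at h1 h2 ⊢
    set n := l.length
    have m1 := fun j => mul_le_mul ha (h1 j) (norm_nonneg _) hr
    have m2 := fun j => mul_le_mul ha (h2 j) (norm_nonneg _) hr
    simp only [← norm_mul] at m1 m2
    cases j with
    | zero =>
      rw [powRemainder_coeff_succ_zero, hookCount_zero_right (by omega)]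
      rw [Nat.cast_add, add_mul, hookCount_mul_pow (N := n + 1) (M := n + d) (by omega),
        hookCount_mul_pow (N := n) (M := n + d) (by omega)]
      refine (norm_sub_le _ _).trans ?_
      linarith [m1 0, m2 0]
    | succ j =>
      rw [powRemainder_coeff_succ_succ, hookCount_succ_succ (by omega)]
      rw [Nat.cast_add, Nat.cast_add, add_mul, add_mul,
        hookCount_mul_pow (N := n + 1) (M := n + d) (by omega),
        hookCount_mul_pow (N := n) (M := n + d) (by omega), Nat.add_sub_add_right]
      refine (norm_sub_le _ _).trans ?_
      have := norm_add_le (a * (powRemainder (a :: l) d).coeff (j + 1))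
        ((powRemainder l (d + 1)).coeff j)
      linarith [m1 (j + 1), m2 (j + 1), h2 j]

/-- The remainder of `X ^ M` modulo `(X - a) ^ N`: the case of equality in
`norm_coeff_powRemainder_le`. -/
theorem coeff_powRemainder_replicate {R : Type*} [CommRing R] (a : R) : ∀ (N d j : ℕ),
    (powRemainder (List.replicate N a) d).coeff j =
      (-1) ^ (N + 1 + j) * (hookCount N (N + d - 1) j * a ^ (N + d - 1 - j))
  | 0, d, j => by simp [powRemainder, hookCount]
  | n + 1, 0, j => by
    rw [List.replicate_succ, powRemainder, Polynomial.coeff_X_pow, List.length_replicate,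
      show n + 1 + 0 - 1 = n by omega, hookCount_succ_self]
    split_ifs with h
    · subst h
      simp [show j + 1 + 1 + j = 2 * (j + 1) by ring, pow_mul]
    · simp
  | n + 1, d + 1, j => by
    have h1 := fun j => coeff_powRemainder_replicate a (n + 1) d j
    have h2 := fun j => coeff_powRemainder_replicate a n (d + 1) j
    simp only [show n + 1 + d - 1 = n + d by omega,
      show n + (d + 1) - 1 = n + d by omega,
      show n + 1 + (d + 1) - 1 = n + d + 1 by omega] at h1 h2 ⊢
    rw [List.replicate_succ] at h1 ⊢
    cases j with
    | zero =>
      rw [powRemainder_coeff_succ_zero, hookCount_zero_right (by omega), h1, h2]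
      rw [Nat.cast_add, add_mul, hookCount_mul_pow (N := n + 1) (M := n + d) (by omega),
        hookCount_mul_pow (N := n) (M := n + d) (by omega)]
      ring
    | succ j =>
      rw [powRemainder_coeff_succ_succ, hookCount_succ_succ (by omega), h1, h2, h2]
      rw [Nat.cast_add, Nat.cast_add, add_mul, add_mul,
        hookCount_mul_pow (N := n + 1) (M := n + d) (by omega),
        hookCount_mul_pow (N := n) (M := n + d) (by omega), Nat.add_sub_add_right]
      ring

theorem continuous_coeff_powRemainder : ∀ (l : List (ℝ → ℂ)) (d j : ℕ),
    (∀ g ∈ l, Continuous g) → Continuous fun s => (powRemainder (l.map (· s)) d).coeff j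
  | [], d, j, _ => by simpa [powRemainder] using continuous_const
  | a :: l, 0, j, _ => by simpa [powRemainder] using continuous_const
  | a :: l, d + 1, j, h => by
    have ha : Continuous a := h a (by simp)
    have h1 := fun j => continuous_coeff_powRemainder (a :: l) d j h
    have h2 := fun j => continuous_coeff_powRemainder l (d + 1) j
      (fun b hb => h b (List.mem_cons_of_mem _ hb))
    simp only [List.map_cons] at h1 ⊢
    cases j with
    | zero =>
      simp only [powRemainder_coeff_succ_zero]
      exact (ha.mul (h1 0)).sub (ha.mul (h2 0))
    | succ j =>
      simp only [powRemainder_coeff_succ_succ]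
      exact ((ha.mul (h1 _)).add (h2 _)).sub (ha.mul (h2 _))

/-- The coefficient of `X ^ j` in the remainder of `X ^ M` modulo `∏ i, (X - u i)`, for `N ≤ M`. -/
noncomputable def interpCoeff {N : ℕ} (M : ℕ) (u : Fin N → ℂ) (j : Fin N) : ℂ :=
  (powRemainder (List.ofFn u) (M + 1 - N)).coeff j

theorem pow_eq_sum_interpCoeff {N M : ℕ} (h : N ≤ M) (u : Fin N → ℂ) (i : Fin N) :
    u i ^ M = ∑ j, interpCoeff M u j * u i ^ (j : ℕ) := by
  cases N with
  | zero => exact i.elim0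
  | succ n =>
    have h1 : (powRemainder (List.ofFn u) (M + 1 - (n + 1))).eval (u i) = u i ^ M := by
      have hm : u i ∈ List.ofFn u := List.mem_ofFn.2 ⟨i, rfl⟩
      rw [List.ofFn_succ] at hm ⊢
      rw [eval_powRemainder _ _ _ hm, List.length_ofFn]
      congr 1
      omega
    rw [← h1, Polynomial.eval_eq_sum_range' (n := n + 1), Finset.sum_range]
    · rfl
    · refine lt_of_le_of_lt (Polynomial.natDegree_le_iff_coeff_eq_zero.2 ?_) n.lt_succ_self
      intro j hj
      exact powRemainder_coeff_of_le _ _ (by rw [List.length_ofFn]; omega)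

theorem norm_interpCoeff_le {N M : ℕ} (h : N ≤ M) {r : ℝ} (hr : 0 ≤ r) (u : Fin N → ℂ)
    (hu : ∀ i, ‖u i‖ ≤ r) (j : Fin N) :
    ‖interpCoeff M u j‖ ≤ hookCount N M j * r ^ (M - j) := by
  have := norm_coeff_powRemainder_le hr (List.ofFn u) (M + 1 - N) j
    (by simpa [List.mem_ofFn] using hu)
  rwa [List.length_ofFn, show N + (M + 1 - N) - 1 = M by omega] at this

theorem interpCoeff_const {N M : ℕ} (h : N ≤ M) (a : ℂ) (j : Fin N) :
    interpCoeff M (fun _ => a) j =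
      (-1) ^ (N + 1 + j) * (hookCount N M j * a ^ (M - j)) := by
  rw [interpCoeff, List.ofFn_const, coeff_powRemainder_replicate,
    show N + (M + 1 - N) - 1 = M by omega]

theorem continuous_interpCoeff {N : ℕ} (M : ℕ) (g : Fin N → ℝ → ℂ) (hg : ∀ i, Continuous (g i))
    (j : Fin N) : Continuous fun s => interpCoeff M (fun i => g i s) j := by
  have := continuous_coeff_powRemainder (List.ofFn g) (M + 1 - N) j
    (by simpa [List.mem_ofFn] using hg)
  simpa only [List.map_ofFn, Function.comp_def, interpCoeff] using this

/-! ### The threshold constant and the perturbed polynomial -/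

theorem thresholdConst_of_le {N M : ℕ} (h : N ≤ M) (c : Fin N → ℝ) (ρ : ℝ) :
    thresholdConst c M ρ = ∑ j : Fin N, (hookCount N M j : ℝ) ^ 2 * (ρ ^ (M - j) / c j) := by
  unfold thresholdConst
  refine Finset.sum_congr rfl fun j _ => ?_
  have hj := j.2
  have hjM : (j : ℕ) ≤ M := by omega
  rw [hookCount, if_pos hj, show (M : ℤ) - (j : ℕ) - 1 = ((M - j - 1 : ℕ) : ℤ) by omega,
    Ring.choose_natCast, show (M : ℤ) - (j : ℕ) = ((M - j : ℕ) : ℤ) by omega, zpow_natCast]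
  push_cast
  ring

/-- For `M < N` the term `j = M` carries the factor `binom(-1, N - M - 1) ^ 2 = 1`, and all the
other terms vanish. -/
theorem thresholdConst_of_lt {N M : ℕ} (h : M < N) (c : Fin N → ℝ) (ρ : ℝ) :
    thresholdConst c M ρ = (c ⟨M, h⟩)⁻¹ := by
  unfold thresholdConst
  rw [Finset.sum_eq_single ⟨M, h⟩]
  · have : Ring.choose ((M : ℤ) - M - 1) (N - M - 1) ^ 2 = 1 := by
      rw [sub_self, zero_sub, Ring.choose_neg]
      simp only [add_sub_cancel_left]
      rw [Ring.choose_natCast, Nat.choose_self]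
      rcases Int.units_eq_one_or (Int.negOnePow ((N - M - 1 : ℕ) : ℤ)) with h | h <;> simp [h]
    have h2 : ((Ring.choose ((M : ℤ) - M - 1) (N - M - 1) : ℤ) : ℝ) ^ 2 = 1 := by
      exact_mod_cast this
    simp only [h2]
    simp
  · intro j _ hj
    rcases lt_trichotomy (j : ℕ) M with hlt | heq | hgt
    · rw [show (M : ℤ) - (j : ℕ) - 1 = ((M - j - 1 : ℕ) : ℤ) by omega, Ring.choose_natCast,
        Nat.choose_eq_zero_of_lt (show M - j - 1 < N - j - 1 by omega)]
      simp
    · exact absurd (Fin.ext heq) hj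
    · rw [Nat.choose_eq_zero_of_lt hgt]
      simp
  · simp

theorem coeff_perturbedPoly {N : ℕ} (c : Fin N → ℝ) (M : ℕ) (c' : ℝ) (k : ℕ) :
    (perturbedPoly c M c').coeff k =
      (if h : k < N then c ⟨k, h⟩ else 0) + if k = M then c' else 0 := by
  rw [perturbedPoly, Polynomial.coeff_add, Polynomial.coeff_C_mul_X_pow,
    Polynomial.finsetSum_coeff]
  congr 1
  simp only [Polynomial.coeff_C_mul_X_pow]
  split_ifs with h
  · rw [Finset.sum_eq_single ⟨k, h⟩]
    · simp
    · intro j _ hj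
      exact if_neg fun e => hj (Fin.ext e.symm)
    · simp
  · exact Finset.sum_eq_zero fun j _ => if_neg (by have := j.2; omega)

theorem aeval_perturbedPoly {N : ℕ} (c : Fin N → ℝ) (M : ℕ) (c' : ℝ) (z : ℂ) :
    Polynomial.aeval z (perturbedPoly c M c') = ∑ j, (c j : ℂ) * z ^ (j : ℕ) + c' * z ^ M := by
  simp [perturbedPoly]

theorem derivative_perturbedPoly {n : ℕ} (c : Fin (n + 1) → ℝ) (M : ℕ) (c' : ℝ) :
    Polynomial.derivative (perturbedPoly c (M + 1) c') =
      perturbedPoly (fun j : Fin n => ((j : ℝ) + 1) * c j.succ) M ((M + 1) * c') := by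
  simp only [perturbedPoly, Fin.sum_univ_succ, Polynomial.derivative_add,
    Polynomial.derivative_sum, Polynomial.derivative_C_mul_X_pow]
  simp [mul_comm]

theorem isHermitian_map_aeval {ι : Type*} {A : Matrix ι ι ℂ} (hA : A.IsHermitian)
    (p : Polynomial ℝ) : (A.map fun z => Polynomial.aeval z p).IsHermitian :=
  hA.map _ fun z => Polynomial.aeval_conj p z

/-- By the Schur product theorem, polynomials with non-negative coefficients preserve positivity. -/
theorem posSemidef_map_aeval_of_coeff_nonneg {ι : Type*} [Finite ι] {A : Matrix ι ι ℂ}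
    (hA : A.PosSemidef) {p : Polynomial ℝ} (hp : ∀ k, 0 ≤ p.coeff k) :
    (A.map fun z => Polynomial.aeval z p).PosSemidef := by
  have hpow : ∀ k : ℕ, (A.map (· ^ k)).PosSemidef := by
    intro k
    induction k with
    | zero =>
      convert Matrix.posSemidef_vecMulVec_self_star (fun _ : ι => (1 : ℂ)) using 1
      ext i j
      simp [Matrix.vecMulVec_apply]
    | succ k ih =>
      have : A.map (· ^ (k + 1)) = (A.map (· ^ k)).hadamard A := by
        ext i j
        simp [pow_succ]
      rw [this]
      exact ih.hadamard hA
  have : (A.map fun z => Polynomial.aeval z p) =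
      ∑ k ∈ Finset.range (p.natDegree + 1), p.coeff k • A.map (· ^ k) := by
    ext i j
    simp [Polynomial.aeval_eq_sum_range, Matrix.sum_apply]
  rw [this]
  exact Matrix.posSemidef_sum _ fun k _ => (hpow k).smul (hp k)

/-! ### Matrices of rank one -/

/-- The pairing `∑ i, conj (x i) * ζ i ^ k` of `x` with the entrywise power `ζ ^ k`. -/
def powerMoment {ι : Type*} [Fintype ι] (ζ x : ι → ℂ) (k : ℕ) : ℂ := ∑ i, star (x i) * ζ i ^ k

theorem star_dotProduct_map_pow_vecMulVec {ι : Type*} [Fintype ι] (ζ x : ι → ℂ) (k : ℕ) :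
    star x ⬝ᵥ (((Matrix.vecMulVec ζ (star ζ)).map (· ^ k)).mulVec x) =
      ((‖powerMoment ζ x k‖ ^ 2 : ℝ) : ℂ) := by
  have h : star (powerMoment ζ x k) = ∑ i, star (ζ i) ^ k * x i := by
    simp [powerMoment, mul_comm]
  rw [← Complex.normSq_eq_norm_sq, Complex.normSq_eq_conj_mul_self, mul_comm]
  change _ = _ * star (powerMoment ζ x k)
  rw [h, powerMoment, Finset.sum_mul_sum]
  simp only [dotProduct, Matrix.mulVec, Finset.mul_sum, Matrix.map_apply, Matrix.vecMulVec_apply,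
    Pi.star_apply]
  refine Finset.sum_congr rfl fun i _ => Finset.sum_congr rfl fun j _ => ?_
  ring

/-- The quadratic form of `f[ζ ζ*]` is diagonal in the moments of `ζ`. -/
theorem star_dotProduct_map_aeval_vecMulVec {ι : Type*} [Fintype ι] {N : ℕ} (c : Fin N → ℝ)
    (M : ℕ) (c' : ℝ) (ζ x : ι → ℂ) :
    star x ⬝ᵥ (((Matrix.vecMulVec ζ (star ζ)).map
      fun z => Polynomial.aeval z (perturbedPoly c M c')).mulVec x) =
      ((∑ j, c j * ‖powerMoment ζ x j‖ ^ 2 + c' * ‖powerMoment ζ x M‖ ^ 2 : ℝ) : ℂ) := by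
  have : ((Matrix.vecMulVec ζ (star ζ)).map
      fun z => Polynomial.aeval z (perturbedPoly c M c')) =
      ∑ j : Fin N, (c j : ℂ) • (Matrix.vecMulVec ζ (star ζ)).map (· ^ (j : ℕ)) +
        (c' : ℂ) • (Matrix.vecMulVec ζ (star ζ)).map (· ^ M) := by
    ext i j
    simp [aeval_perturbedPoly, Matrix.sum_apply]
  rw [this, Matrix.add_mulVec, Matrix.sum_mulVec, dotProduct_add, dotProduct_sum]
  simp only [Matrix.smul_mulVec, dotProduct_smul, star_dotProduct_map_pow_vecMulVec, smul_eq_mul]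
  push_cast
  rfl

theorem powerMoment_eq_sum_interpCoeff {N M : ℕ} (h : N ≤ M) (ζ x : Fin N → ℂ) :
    powerMoment ζ x M = ∑ j : Fin N, interpCoeff M ζ j * powerMoment ζ x j := by
  simp only [powerMoment, Finset.mul_sum]
  rw [Finset.sum_comm]
  refine Finset.sum_congr rfl fun i _ => ?_
  rw [pow_eq_sum_interpCoeff h, Finset.mul_sum]
  exact Finset.sum_congr rfl fun j _ => by ring

theorem thresholdConst_nonneg {N M : ℕ} (h : N ≤ M) {c : Fin N → ℝ} (hc : ∀ j, 0 < c j) {ρ : ℝ}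
    (hρ : 0 ≤ ρ) : 0 ≤ thresholdConst c M ρ := by
  rw [thresholdConst_of_le h]
  exact Finset.sum_nonneg fun j _ =>
    mul_nonneg (sq_nonneg _) (div_nonneg (pow_nonneg hρ _) (hc j).le)

theorem sum_norm_interpCoeff_sq_div_le {N M : ℕ} (h : N ≤ M) {c : Fin N → ℝ} (hc : ∀ j, 0 < c j)
    {ρ : ℝ} (hρ : 0 ≤ ρ) (ζ : Fin N → ℂ) (hζ : ∀ i, ‖ζ i‖ ^ 2 ≤ ρ) :
    ∑ j, ‖interpCoeff M ζ j‖ ^ 2 / c j ≤ thresholdConst c M ρ := by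
  rw [thresholdConst_of_le h]
  refine Finset.sum_le_sum fun j _ => ?_
  rw [← mul_div_assoc]
  refine div_le_div_of_nonneg_right ?_ (hc j).le
  have h1 := norm_interpCoeff_le h (Real.sqrt_nonneg ρ) ζ
    (fun i => Real.le_sqrt_of_sq_le (hζ i)) j
  refine (pow_le_pow_left₀ (norm_nonneg _) h1 2).trans_eq ?_
  rw [mul_pow, ← pow_mul, mul_comm (M - (j : ℕ)), pow_mul, Real.sq_sqrt hρ]

theorem norm_powerMoment_sq_le {N M : ℕ} (h : N ≤ M) {c : Fin N → ℝ} (hc : ∀ j, 0 < c j)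
    {ρ : ℝ} (hρ : 0 ≤ ρ) (ζ x : Fin N → ℂ) (hζ : ∀ i, ‖ζ i‖ ^ 2 ≤ ρ) :
    ‖powerMoment ζ x M‖ ^ 2 ≤
      thresholdConst c M ρ * ∑ j : Fin N, c j * ‖powerMoment ζ x j‖ ^ 2 := by
  rw [powerMoment_eq_sum_interpCoeff h]
  have h1 := norm_sum_le Finset.univ fun j : Fin N => interpCoeff M ζ j * powerMoment ζ x j
  refine (pow_le_pow_left₀ (norm_nonneg _) h1 2).trans ?_
  refine (Finset.sum_sq_le_sum_mul_sum_of_sq_le_mul Finset.univ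
    (f := fun j : Fin N => ‖interpCoeff M ζ j‖ ^ 2 / c j)
    (g := fun j : Fin N => c j * ‖powerMoment ζ x j‖ ^ 2)
    (fun j _ => div_nonneg (sq_nonneg _) (hc j).le)
    (fun j _ => mul_nonneg (hc j).le (sq_nonneg _)) fun j _ => ?_).trans ?_
  · have := (hc j).ne'
    rw [norm_mul]
    refine le_of_eq ?_
    field_simp
  · exact mul_le_mul_of_nonneg_right (sum_norm_interpCoeff_sq_div_le h hc hρ ζ hζ)
      (Finset.sum_nonneg fun j _ => mul_nonneg (hc j).le (sq_nonneg _))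

/-- The threshold is sufficient on matrices of rank one: the moment of order `M` is a linear
combination of those of order `< N`, and is controlled by Cauchy–Schwarz. -/
theorem posSemidef_map_aeval_vecMulVec {N M : ℕ} (h : N ≤ M) {c : Fin N → ℝ} (hc : ∀ j, 0 < c j)
    {ρ : ℝ} (hρ : 0 ≤ ρ) {c' : ℝ} (hc' : 0 ≤ 1 + c' * thresholdConst c M ρ)
    (ζ : Fin N → ℂ) (hζ : ∀ i, ‖ζ i‖ ^ 2 ≤ ρ) :
    ((Matrix.vecMulVec ζ (star ζ)).map
      fun z => Polynomial.aeval z (perturbedPoly c M c')).PosSemidef := by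
  refine .of_dotProduct_mulVec_nonneg (isHermitian_map_aeval
    (Matrix.posSemidef_vecMulVec_self_star ζ).isHermitian _) fun x => ?_
  rw [star_dotProduct_map_aeval_vecMulVec, Complex.zero_le_real]
  have hS : 0 ≤ ∑ j : Fin N, c j * ‖powerMoment ζ x j‖ ^ 2 :=
    Finset.sum_nonneg fun j _ => mul_nonneg (hc j).le (sq_nonneg _)
  rcases le_total 0 c' with hpos | hneg
  · exact add_nonneg hS (mul_nonneg hpos (sq_nonneg _))
  · have h1 := mul_le_mul_of_nonpos_left (norm_powerMoment_sq_le h hc hρ ζ x hζ) hneg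
    nlinarith [mul_nonneg hc' hS]

/-! ### From rank one to arbitrary rank -/

/-- A positive semidefinite matrix exceeds a positive semidefinite matrix of rank at most one that
has the same row and column of index `0`. -/
theorem Matrix.PosSemidef.exists_vecMulVec_sub {n : ℕ} {A : Matrix (Fin (n + 1)) (Fin (n + 1)) ℂ}
    (hA : A.PosSemidef) : ∃ ζ : Fin (n + 1) → ℂ,
      (A - Matrix.vecMulVec ζ (star ζ)).PosSemidef ∧
      (∀ j, A 0 j = Matrix.vecMulVec ζ (star ζ) 0 j) ∧
      ∀ i, A i 0 = Matrix.vecMulVec ζ (star ζ) i 0 := by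
  have hH : ∀ i j, star (A i j) = A j i := fun i j => hA.isHermitian.apply j i
  obtain ⟨a, ha, haA⟩ : ∃ a : ℝ, 0 ≤ a ∧ A 0 0 = a := by
    have := hA.diag_nonneg (i := 0)
    rw [Complex.nonneg_iff] at this
    exact ⟨_, this.1, Complex.ext rfl this.2.symm⟩
  rcases ha.eq_or_lt with rfl | ha
  · have hcol : ∀ i, A i 0 = 0 := by
      have := (hA.dotProduct_mulVec_zero_iff (Pi.single 0 1)).1 (by simp [haA])
      intro i
      simpa using congrFun this i
    refine ⟨0, by simpa using hA, fun j => ?_, fun i => by simp [hcol]⟩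
    rw [← hH, hcol]
    simp
  · have hs : ((√a : ℝ) : ℂ) * ((√a : ℝ) : ℂ) = a := by
      rw [← Complex.ofReal_mul, Real.mul_self_sqrt ha.le]
    have hs0 : ((√a : ℝ) : ℂ) ≠ 0 := by
      exact_mod_cast (Real.sqrt_pos.2 ha).ne'
    have ha0 : (a : ℂ) ≠ 0 := by exact_mod_cast ha.ne'
    set ζ : Fin (n + 1) → ℂ := fun i => A i 0 / (√a : ℝ) with hζ
    have hZ : ∀ i j, Matrix.vecMulVec ζ (star ζ) i j = A i 0 * A 0 j / a := by
      intro i j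
      rw [Matrix.vecMulVec_apply, Pi.star_apply, hζ]
      simp only [star_div₀, hH]
      rw [Complex.star_def, Complex.conj_ofReal, div_mul_div_comm, hs]
    refine ⟨ζ, ?_, fun j => ?_, fun i => ?_⟩
    · -- `Q` projects along the basis vector of index `0`, onto the kernel of the row `A 0`.
      set Q : Matrix (Fin (n + 1)) (Fin (n + 1)) ℂ :=
        1 - Matrix.vecMulVec (Pi.single 0 1) (fun j => A 0 j / a) with hQ
      convert hA.conjTranspose_mul_mul_same Q using 1
      have h1 : A * Q = A - Matrix.vecMulVec ζ (star ζ) := by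
        ext i j
        rw [hQ, mul_sub, mul_one, Matrix.sub_apply, Matrix.sub_apply, hZ, Matrix.mul_vecMulVec,
          Matrix.vecMulVec_apply]
        simp
        ring
      have h2 : (A * Q) 0 = 0 := by
        ext j
        rw [h1, Matrix.sub_apply, hZ, haA]
        field_simp
        simp
      rw [mul_assoc, ← h1, hQ, Matrix.conjTranspose_sub, Matrix.conjTranspose_one, sub_mul, one_mul,
        ← hQ]
      rw [Matrix.conjTranspose_vecMulVec, Matrix.vecMulVec_mul, eq_comm, sub_eq_self]
      ext i j
      rw [Matrix.vecMulVec_apply]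
      have : Matrix.vecMul (star (Pi.single 0 1 : Fin (n + 1) → ℂ)) (A * Q) j = 0 := by
        have : star (Pi.single 0 1 : Fin (n + 1) → ℂ) = Pi.single 0 1 := by
          ext k
          by_cases hk : k = 0
          · subst hk; simp
          · simp [hk]
        rw [this, Matrix.single_one_vecMul]
        exact congrFun h2 j
      rw [this]
      simp
    · rw [hZ, haA]; field_simp
    · rw [hZ, haA]; field_simp

theorem Matrix.posSemidef_of_row_col_zero {n : ℕ} {D : Matrix (Fin (n + 1)) (Fin (n + 1)) ℂ}
    (hrow : ∀ j, D 0 j = 0) (hcol : ∀ i, D i 0 = 0)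
    (hD : (D.submatrix Fin.succ Fin.succ).PosSemidef) : D.PosSemidef := by
  refine .of_dotProduct_mulVec_nonneg ?_ fun x => ?_
  · refine Matrix.IsHermitian.ext fun i j => ?_
    refine Fin.cases ?_ (fun i => ?_) i
    · rw [hcol, hrow, star_zero]
    · refine Fin.cases ?_ (fun j => ?_) j
      · rw [hcol, hrow, star_zero]
      · exact hD.isHermitian.apply i j
  · have := hD.dotProduct_mulVec_nonneg (fun i => x i.succ)
    simpa [dotProduct, Matrix.mulVec, Fin.sum_univ_succ, hrow, hcol] using this

/-- The derivative of the quadratic form of `p[Z + t B]` is that of the Schur product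
`B ∘ p'[Z + t B]`. -/
theorem hasDerivAt_quadraticForm_map {ι : Type*} [Fintype ι] (p : Polynomial ℝ)
    (Z B : Matrix ι ι ℂ) (x : ι → ℂ) (t : ℝ) :
    HasDerivAt
      (fun t : ℝ => (star x ⬝ᵥ ((Z + t • B).map fun z => Polynomial.aeval z p).mulVec x).re)
      (star x ⬝ᵥ (B.hadamard ((Z + t • B).map
        fun z => Polynomial.aeval z (Polynomial.derivative p))).mulVec x).re t := by
  have hentry : ∀ i j, HasDerivAt (fun t : ℝ => Polynomial.aeval ((Z + t • B) i j) p)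
      (B i j * Polynomial.aeval ((Z + t • B) i j) (Polynomial.derivative p)) t := by
    intro i j
    have h1 : HasDerivAt (fun t : ℝ => (Z + t • B) i j) (B i j) t := by
      simpa using ((hasDerivAt_id t).ofReal_comp.mul_const (B i j)).const_add (Z i j)
    have h2 := (Polynomial.hasDerivAt_aeval p ((Z + t • B) i j)).comp t h1
    rwa [mul_comm] at h2
  have : HasDerivAt
      (fun t : ℝ => star x ⬝ᵥ ((Z + t • B).map fun z => Polynomial.aeval z p).mulVec x)
      (star x ⬝ᵥ (B.hadamard ((Z + t • B).map
        fun z => Polynomial.aeval z (Polynomial.derivative p))).mulVec x) t := by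
    simp only [dotProduct, Matrix.mulVec]
    refine HasDerivAt.fun_sum fun i _ => HasDerivAt.const_mul _ ?_
    exact HasDerivAt.fun_sum fun j _ => (hentry i j).mul_const _
  exact Complex.reCLM.hasFDerivAt.comp_hasDerivAt t this

/-- The threshold for `f` in dimension `n + 1` is at least as strict as the one for `f'` in
dimension `n`. -/
theorem mul_thresholdConst_le {n M : ℕ} (h : n ≤ M) {c : Fin (n + 1) → ℝ} (hc : ∀ j, 0 < c j)
    {ρ : ℝ} (hρ : 0 ≤ ρ) :
    ((M : ℝ) + 1) * thresholdConst (fun j : Fin n => ((j : ℝ) + 1) * c j.succ) M ρ ≤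
      thresholdConst c (M + 1) ρ := by
  rw [thresholdConst_of_le h, thresholdConst_of_le (Nat.add_le_add_right h 1), Fin.sum_univ_succ,
    Finset.mul_sum]
  refine le_add_of_nonneg_of_le (mul_nonneg (sq_nonneg _) (div_nonneg (pow_nonneg hρ _) (hc 0).le))
    (Finset.sum_le_sum fun j _ => ?_)
  have hb : ((j : ℝ) + 1) * hookCount (n + 1) (M + 1) (j + 1) = (M + 1) * hookCount n M j := by
    exact_mod_cast succ_mul_hookCount_succ n M j
  have hjM : (j : ℝ) + 1 ≤ M + 1 := by
    have : (j : ℕ) ≤ M := by omega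
    exact_mod_cast Nat.succ_le_succ this
  have hj0 : (0 : ℝ) < (j : ℝ) + 1 := by positivity
  have hcj := hc j.succ
  rw [Fin.val_succ, Nat.add_sub_add_right]
  have hb' : (hookCount (n + 1) (M + 1) (j + 1) : ℝ) =
      (M + 1) * hookCount n M j / ((j : ℝ) + 1) := by
    rw [← hb]; field_simp
  rw [hb']
  have hq : 0 ≤ (M + 1 : ℝ) * (hookCount n M j : ℝ) ^ 2 * (ρ ^ (M - (j : ℕ)) / c j.succ) /
      ((j : ℝ) + 1) := by positivity
  calc _ = (M + 1 : ℝ) * (hookCount n M j : ℝ) ^ 2 * (ρ ^ (M - (j : ℕ)) / c j.succ) /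
      ((j : ℝ) + 1) * 1 := by field_simp
    _ ≤ (M + 1 : ℝ) * (hookCount n M j : ℝ) ^ 2 * (ρ ^ (M - (j : ℕ)) / c j.succ) /
      ((j : ℝ) + 1) * (((M : ℝ) + 1) / ((j : ℝ) + 1)) :=
        mul_le_mul_of_nonneg_left ((one_le_div hj0).2 hjM) hq
    _ = _ := by field_simp

/-- The threshold is sufficient on all positive semidefinite matrices with entries in the disc. The
proof is by induction on the dimension: `f` preserves positivity on matrices of rank one, and along
the segment from `ζ ζ*` to `A` the derivative of `f[-]` is the Schur product of `A - ζ ζ*`, which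
lives in one dimension less, with a matrix `f'[-]`. -/
theorem posSemidef_map_aeval_of_threshold {ρ : ℝ} (hρ : 0 ≤ ρ) : ∀ (N M : ℕ), N ≤ M →
    ∀ (c : Fin N → ℝ), (∀ j, 0 < c j) → ∀ c' : ℝ, 0 ≤ 1 + c' * thresholdConst c M ρ →
    ∀ A : Matrix (Fin N) (Fin N) ℂ, A.PosSemidef → (∀ i j, ‖A i j‖ ≤ ρ) →
    (A.map fun z => Polynomial.aeval z (perturbedPoly c M c')).PosSemidef
  | 0, M, _, c, _, c', _, A, _, _ => by
    convert Matrix.PosSemidef.zero using 1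
    exact Subsingleton.elim _ _
  | n + 1, 0, h, _, _, _, _, _, _, _ => absurd h (by omega)
  | n + 1, M + 1, h, c, hc, c', hc', A, hA, hAρ => by
    have hnM : n ≤ M := Nat.le_of_succ_le_succ h
    obtain ⟨ζ, hB, hrow, hcol⟩ := hA.exists_vecMulVec_sub
    set Z := Matrix.vecMulVec ζ (star ζ) with hZ
    set B := A - Z with hBdef
    have hZpsd : Z.PosSemidef := Matrix.posSemidef_vecMulVec_self_star ζ
    have hζ : ∀ i, ‖ζ i‖ ^ 2 ≤ ρ := by
      intro i
      have h1 : Z i i = ((‖ζ i‖ ^ 2 : ℝ) : ℂ) := by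
        rw [hZ, Matrix.vecMulVec_apply, Pi.star_apply, Complex.star_def, Complex.mul_conj,
          Complex.normSq_eq_norm_sq]
      have h2 : 0 ≤ A i i - Z i i := hB.diag_nonneg
      rw [h1, sub_nonneg] at h2
      exact (Complex.le_def.1 h2).1.trans ((Complex.re_le_norm _).trans (hAρ i i))
    have hZρ : ∀ i j, ‖Z i j‖ ≤ ρ := by
      intro i j
      rw [hZ, Matrix.vecMulVec_apply, Pi.star_apply, norm_mul, norm_star]
      nlinarith [hζ i, hζ j, sq_nonneg (‖ζ i‖ - ‖ζ j‖)]
    -- The leading coefficient of `f'` satisfies the threshold in dimension `n`.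
    have hder : 0 ≤ 1 + ((M : ℝ) + 1) * c' *
        thresholdConst (fun j : Fin n => ((j : ℝ) + 1) * c j.succ) M ρ := by
      have hT := mul_thresholdConst_le hnM hc hρ
      have hT0 : 0 ≤ thresholdConst (fun j : Fin n => ((j : ℝ) + 1) * c j.succ) M ρ :=
        thresholdConst_nonneg hnM (fun j => mul_pos (by positivity) (hc _)) hρ
      rcases le_total 0 c' with hpos | hneg
      · positivity
      · nlinarith [mul_le_mul_of_nonpos_left hT hneg]
    have hpath : ∀ t ∈ Set.Icc (0 : ℝ) 1, (B.hadamard ((Z + t • B).map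
        fun z => Polynomial.aeval z (Polynomial.derivative
          (perturbedPoly c (M + 1) c')))).PosSemidef := by
      intro t ht
      have hAt : Z + t • B = (1 - t) • Z + t • A := by
        rw [hBdef]; module
      refine Matrix.posSemidef_of_row_col_zero (fun j => ?_) (fun i => ?_) ?_
      · simp [hBdef, hrow j]
      · simp [hBdef, hcol i]
      · rw [derivative_perturbedPoly]
        have hblock := posSemidef_map_aeval_of_threshold hρ n M hnM
          (fun j : Fin n => ((j : ℝ) + 1) * c j.succ)
          (fun j => mul_pos (by positivity) (hc _)) _ hder
          ((Z + t • B).submatrix Fin.succ Fin.succ)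
          ((hZpsd.add (hB.smul ht.1)).submatrix _) (fun i j => ?_)
        · exact (hB.submatrix Fin.succ).hadamard hblock
        · rw [hAt, Matrix.submatrix_apply, Matrix.add_apply, Matrix.smul_apply, Matrix.smul_apply]
          refine (norm_add_le _ _).trans ?_
          rw [norm_smul, norm_smul, Real.norm_of_nonneg ht.1,
            Real.norm_of_nonneg (sub_nonneg.2 ht.2)]
          nlinarith [hZρ i.succ j.succ, hAρ i.succ j.succ, ht.1, ht.2]
    refine .of_dotProduct_mulVec_nonneg (isHermitian_map_aeval hA.isHermitian _) fun x => ?_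
    rw [Complex.nonneg_iff]
    refine ⟨?_, ((isHermitian_map_aeval hA.isHermitian _).im_star_dotProduct_mulVec_self x).symm⟩
    have hmono : MonotoneOn (fun t : ℝ => (star x ⬝ᵥ ((Z + t • B).map
        fun z => Polynomial.aeval z (perturbedPoly c (M + 1) c')).mulVec x).re)
        (Set.Icc 0 1) := by
      refine monotoneOn_of_hasDerivWithinAt_nonneg (convex_Icc 0 1)
        (fun t _ => (hasDerivAt_quadraticForm_map _ Z B x t).continuousAt.continuousWithinAt)
        (fun t _ => (hasDerivAt_quadraticForm_map _ Z B x t).hasDerivWithinAt) fun t ht => ?_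
      rw [interior_Icc] at ht
      exact (Complex.nonneg_iff.1
        ((hpath t ⟨ht.1.le, ht.2.le⟩).dotProduct_mulVec_nonneg x)).1
    have h0 := (posSemidef_map_aeval_vecMulVec h hc hρ hc' ζ hζ).dotProduct_mulVec_nonneg x
    have h01 := hmono (Set.left_mem_Icc.2 zero_le_one) (Set.right_mem_Icc.2 zero_le_one)
      zero_le_one
    simp only [zero_smul, add_zero, one_smul] at h01
    rw [show Z + B = A by rw [hBdef]; abel] at h01
    exact (Complex.nonneg_iff.1 h0).1.trans h01

/-! ### Necessity of the threshold -/

/-- At distinct nodes the moments of order `< N` can be prescribed, by Vandermonde. -/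
theorem exists_powerMoment_eq {N : ℕ} {ζ : Fin N → ℂ} (hζ : Function.Injective ζ)
    (t : Fin N → ℂ) : ∃ x, ∀ j : Fin N, powerMoment ζ x j = t j := by
  have hdet : IsUnit (Matrix.vandermonde ζ).det :=
    isUnit_iff_ne_zero.2 (Matrix.det_vandermonde_ne_zero_iff.2 hζ)
  refine ⟨star (Matrix.vecMul t (Matrix.vandermonde ζ)⁻¹), fun j => ?_⟩
  have : Matrix.vecMul (Matrix.vecMul t (Matrix.vandermonde ζ)⁻¹) (Matrix.vandermonde ζ) = t := by
    rw [Matrix.vecMul_vecMul, Matrix.nonsing_inv_mul _ hdet, Matrix.vecMul_one]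
  simpa [powerMoment, Matrix.vecMul, dotProduct, Matrix.vandermonde_apply] using congrFun this j

theorem powerMoment_form_nonneg {ρ : ℝ} {N M : ℕ} {c : Fin N → ℝ} {c' : ℝ}
    (hf : PreservesPositivity (fun z : ℂ => Polynomial.aeval z (perturbedPoly c M c'))
      (PSDMatrices N 1 (Complex.ofReal '' Set.Ioo 0 ρ)))
    {u : Fin N → ℝ} (hu : ∀ i, u i ∈ Set.Ioo 0 (√ρ)) (x : Fin N → ℂ) :
    0 ≤ ∑ j : Fin N, c j * ‖powerMoment (fun i => (u i : ℂ)) x j‖ ^ 2 +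
      c' * ‖powerMoment (fun i => (u i : ℂ)) x M‖ ^ 2 := by
  set ζ : Fin N → ℂ := fun i => (u i : ℂ) with hζ
  have hmem : Matrix.vecMulVec ζ (star ζ) ∈ PSDMatrices N 1 (Complex.ofReal '' Set.Ioo 0 ρ) := by
    refine ⟨Matrix.posSemidef_vecMulVec_self_star ζ, fun i j => ⟨u i * u j, ?_, ?_⟩,
      Matrix.rank_vecMulVec_le _ _⟩
    · have hρ : 0 ≤ ρ := (Real.sqrt_pos.1 ((hu i).1.trans (hu i).2)).le
      refine ⟨mul_pos (hu i).1 (hu j).1, ?_⟩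
      rw [← Real.mul_self_sqrt hρ]
      exact mul_lt_mul'' (hu i).2 (hu j).2 (hu i).1.le (hu j).1.le
    · simp [hζ, Matrix.vecMulVec_apply]
  have := (hf _ hmem).dotProduct_mulVec_nonneg x
  rwa [star_dotProduct_map_aeval_vecMulVec, Complex.zero_le_real] at this

theorem exists_injective_mem_Ioo (N : ℕ) {r : ℝ} (hr : 0 < r) :
    ∃ v : Fin N → ℝ, Function.Injective v ∧ ∀ i, v i ∈ Set.Ioo 0 r := by
  have : (Set.Ioo 0 r).Infinite := Set.Ioo_infinite hr
  have := this.to_subtype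
  refine ⟨fun i => Infinite.natEmbedding (Set.Ioo 0 r) i, fun i j h => ?_, fun i => Subtype.prop _⟩
  exact Fin.ext ((Infinite.natEmbedding (Set.Ioo 0 r)).injective (Subtype.ext h))

/-- Positivity of `f[u uᵀ]` for distinct nodes `u i` in `(0, √ρ)` is an inequality in the prescribed
moments `t`. It passes to the limit where all nodes coincide, the endpoints `0` and `√ρ` included. -/
theorem interpCoeff_const_form_nonneg {ρ : ℝ} (hρ : 0 < ρ) {N M : ℕ} (hNM : N ≤ M)
    {c : Fin N → ℝ} {c' : ℝ}
    (hf : PreservesPositivity (fun z : ℂ => Polynomial.aeval z (perturbedPoly c M c'))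
      (PSDMatrices N 1 (Complex.ofReal '' Set.Ioo 0 ρ)))
    {a : ℝ} (ha : a ∈ Set.Icc 0 (√ρ)) (t : Fin N → ℂ) :
    0 ≤ ∑ j : Fin N, c j * ‖t j‖ ^ 2 +
      c' * ‖∑ j, interpCoeff M (fun _ : Fin N => (a : ℂ)) j * t j‖ ^ 2 := by
  obtain ⟨v, hvinj, hv⟩ := exists_injective_mem_Ioo N (Real.sqrt_pos.2 hρ)
  -- The segments from `a` to distinct interior nodes stay in `(0, √ρ)` for `0 < s ≤ 1`.
  set g : Fin N → ℝ → ℂ := fun i s => ((a + s * (v i - a) : ℝ) : ℂ) with hg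
  have hgc : ∀ i, Continuous (g i) := fun i => by simp only [hg]; fun_prop
  have hcont : Continuous fun s : ℝ => ∑ j : Fin N, c j * ‖t j‖ ^ 2 +
      c' * ‖∑ j, interpCoeff M (fun i => g i s) j * t j‖ ^ 2 := by
    refine continuous_const.add (continuous_const.mul (Continuous.pow ?_ 2))
    refine (continuous_finsetSum _ fun j _ => ?_).norm
    exact (continuous_interpCoeff M g hgc j).mul continuous_const
  have hpos : ∀ s ∈ Set.Ioc (0 : ℝ) 1, 0 ≤ ∑ j : Fin N, c j * ‖t j‖ ^ 2 +
      c' * ‖∑ j, interpCoeff M (fun i => g i s) j * t j‖ ^ 2 := by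
    intro s hs
    have hu : ∀ i, a + s * (v i - a) ∈ Set.Ioo 0 (√ρ) := by
      intro i
      obtain ⟨h1, h2⟩ := hv i
      obtain ⟨h3, h4⟩ := ha
      obtain ⟨h5, h6⟩ := hs
      constructor
      · nlinarith [mul_pos h5 h1]
      · nlinarith [mul_pos h5 (sub_pos.2 h2)]
    have hinj : Function.Injective fun i => g i s := by
      intro i j h
      have h := Complex.ofReal_injective h
      have := mul_left_cancel₀ hs.1.ne' (add_left_cancel h)
      exact hvinj (sub_left_injective this)
    obtain ⟨x, hx⟩ := exists_powerMoment_eq hinj t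
    have := powerMoment_form_nonneg hf hu x
    change 0 ≤ ∑ j : Fin N, c j * ‖powerMoment (fun i => g i s) x j‖ ^ 2 +
      c' * ‖powerMoment (fun i => g i s) x M‖ ^ 2 at this
    rw [powerMoment_eq_sum_interpCoeff hNM] at this
    simpa only [hx] using this
  have hlim := (hcont.tendsto 0).mono_left (nhdsWithin_le_nhds (s := Set.Ioi 0))
  simp only [hg, zero_mul, add_zero] at hlim
  refine ge_of_tendsto hlim ?_
  filter_upwards [Ioc_mem_nhdsGT (zero_lt_one' ℝ)] with s hs using hpos s hs

/-- Testing with unit moment vectors, at nodes tending to `0` and to `√ρ`, gives the signs of the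
`c j`. Testing with the moments for which Cauchy–Schwarz is an equality, at nodes tending to `√ρ`,
gives the threshold. -/
theorem condition_of_preserves_rank_one {ρ : ℝ} (hρ : 0 < ρ) {N M : ℕ} (hN : 1 ≤ N)
    (c : Fin N → ℝ) (c' : ℝ)
    (hf : PreservesPositivity (fun z : ℂ => Polynomial.aeval z (perturbedPoly c M c'))
      (PSDMatrices N 1 (Complex.ofReal '' Set.Ioo 0 ρ))) :
    (∀ k : ℕ, 0 ≤ (perturbedPoly c M c').coeff k) ∨
      ((∀ j, 0 < c j) ∧ -(thresholdConst c M ρ)⁻¹ ≤ c') := by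
  rcases lt_or_ge M N with hMN | hNM
  · left
    intro k
    rw [coeff_perturbedPoly]
    by_cases hk : k < N
    · obtain ⟨v, hvinj, hv⟩ := exists_injective_mem_Ioo N (Real.sqrt_pos.2 hρ)
      obtain ⟨x, hx⟩ := exists_powerMoment_eq
        (ζ := fun i => (v i : ℂ)) (Complex.ofReal_injective.comp hvinj) (Pi.single ⟨k, hk⟩ 1)
      have h1 := powerMoment_form_nonneg hf hv x
      simp only [hx, show powerMoment (fun i => (v i : ℂ)) x M = _ from hx ⟨M, hMN⟩] at h1
      rw [Finset.sum_eq_single ⟨k, hk⟩ (fun j _ hj => by simp [hj]) (by simp)] at h1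
      by_cases hkM : k = M
      · subst hkM
        simpa [hk] using h1
      · simpa [hk, hkM, Ne.symm hkM, Pi.single_apply] using h1
    · rw [dif_neg hk, if_neg (by omega), add_zero]
  · have hsingle : ∀ (k : Fin N) (a : ℝ), a ∈ Set.Icc 0 (√ρ) →
        0 ≤ c k + c' * ((hookCount N M k : ℝ) * a ^ (M - k)) ^ 2 := by
      intro k a ha
      have h1 := interpCoeff_const_form_nonneg hρ hNM hf ha (Pi.single k 1)
      rw [Finset.sum_eq_single k (fun j _ hj => by simp [hj]) (by simp),
        Finset.sum_eq_single k (fun j _ hj => by simp [hj]) (by simp),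
        interpCoeff_const hNM] at h1
      simpa [abs_of_nonneg ha.1] using h1
    -- At `a = 0` the perturbation drops out, since `k < N ≤ M`.
    have hc0 : ∀ k, 0 ≤ c k := by
      intro k
      have h1 := hsingle k 0 (Set.left_mem_Icc.2 (Real.sqrt_nonneg ρ))
      rw [zero_pow (by omega)] at h1
      simpa using h1
    rcases le_or_gt 0 c' with hc' | hc'
    · left
      intro k
      rw [coeff_perturbedPoly]
      refine add_nonneg ?_ ?_
      · split_ifs
        exacts [hc0 _, le_rfl]
      · split_ifs
        exacts [hc', le_rfl]
    · right
      have hρ' := Real.sqrt_pos.2 hρ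
      have hcount : ∀ k : Fin N, (0 : ℝ) < hookCount N M k := by
        intro k
        have hk := k.2
        rw [hookCount, if_pos hk]
        exact_mod_cast Nat.mul_pos (Nat.choose_pos (by omega)) (Nat.choose_pos (by omega))
      have hc : ∀ k, 0 < c k := by
        intro k
        have h1 := hsingle k _ (Set.right_mem_Icc.2 (Real.sqrt_nonneg ρ))
        have h2 : 0 < ((hookCount N M k : ℝ) * √ρ ^ (M - (k : ℕ))) ^ 2 := by
          have := hcount k
          positivity
        nlinarith [mul_pos (neg_pos.2 hc') h2]
      refine ⟨hc, ?_⟩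
      set w : Fin N → ℂ := interpCoeff M (fun _ : Fin N => ((√ρ : ℝ) : ℂ)) with hw
      have hwT : ∑ j, ‖w j‖ ^ 2 / c j = thresholdConst c M ρ := by
        rw [thresholdConst_of_le hNM]
        refine Finset.sum_congr rfl fun j _ => ?_
        have : ‖w j‖ = hookCount N M j * √ρ ^ (M - (j : ℕ)) := by
          rw [hw, interpCoeff_const hNM]
          simp [abs_of_nonneg (Real.sqrt_nonneg ρ)]
        rw [this, mul_pow, ← pow_mul, mul_comm (M - (j : ℕ)), pow_mul, Real.sq_sqrt hρ.le,
          mul_div_assoc]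
      have hT : 0 < thresholdConst c M ρ := by
        rw [thresholdConst_of_le hNM]
        have : Nonempty (Fin N) := ⟨⟨0, hN⟩⟩
        refine Finset.sum_pos (fun j _ => ?_) Finset.univ_nonempty
        have := hcount j
        have := hc j
        positivity
      -- With these moments the inequality reads `0 ≤ T + c' * T ^ 2`, `T` being the threshold
      -- constant.
      have h1 := interpCoeff_const_form_nonneg hρ hNM hf (Set.right_mem_Icc.2 (Real.sqrt_nonneg ρ))
        fun j => star (w j) / (c j : ℂ)
      have h2 : ∑ j, c j * ‖star (w j) / (c j : ℂ)‖ ^ 2 = thresholdConst c M ρ := by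
        rw [← hwT]
        refine Finset.sum_congr rfl fun j _ => ?_
        have := hc j
        rw [norm_div, norm_star, Complex.norm_real, Real.norm_of_nonneg this.le]
        field_simp
      have h3 : ∑ j, w j * (star (w j) / (c j : ℂ)) = ((thresholdConst c M ρ : ℝ) : ℂ) := by
        rw [← hwT]
        push_cast
        refine Finset.sum_congr rfl fun j _ => ?_
        rw [← mul_div_assoc, Complex.star_def, Complex.mul_conj, Complex.normSq_eq_norm_sq]
        push_cast
        rfl
      rw [← hw, h2, h3, Complex.norm_real, Real.norm_of_nonneg hT.le] at h1
      have h4 : 0 ≤ 1 + c' * thresholdConst c M ρ := by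
        by_contra hlt
        nlinarith [mul_pos hT (neg_pos.2 (not_le.1 hlt))]
      rw [neg_le, inv_eq_one_div, le_div_iff₀ hT]
      linarith

theorem theorem1p4 (ρ : ℝ) (hρ : 0 < ρ) (N M : ℕ) (hN : 1 ≤ N) (c : Fin N → ℝ) (c' : ℝ) :
    List.TFAE [
      PreservesPositivity (fun z : ℂ => Polynomial.aeval z (perturbedPoly c M c'))
        (PSDMatrices N N (Metric.closedBall (0 : ℂ) ρ)),
      (∀ k : ℕ, 0 ≤ (perturbedPoly c M c').coeff k) ∨
        ((∀ j, 0 < c j) ∧ -(thresholdConst c M ρ)⁻¹ ≤ c'),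
      PreservesPositivity (fun z : ℂ => Polynomial.aeval z (perturbedPoly c M c'))
        (PSDMatrices N 1 (Complex.ofReal '' Set.Ioo 0 ρ))] := by
  tfae_have 1 → 3 := by
    rintro h A ⟨hA, hAI, hrank⟩
    refine h A ⟨hA, fun i j => ?_, hrank.trans hN⟩
    obtain ⟨y, hy, hyA⟩ := hAI i j
    rw [← hyA, mem_closedBall_zero_iff, Complex.norm_real, Real.norm_of_nonneg hy.1.le]
    exact hy.2.le
  tfae_have 3 → 2 := condition_of_preserves_rank_one hρ hN c c'
  tfae_have 2 → 1 := by
    rintro (h | ⟨hc, hc'⟩) A ⟨hA, hAI, -⟩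
    · exact posSemidef_map_aeval_of_coeff_nonneg hA h
    rcases lt_or_ge M N with hMN | hNM
    · refine posSemidef_map_aeval_of_coeff_nonneg hA fun k => ?_
      rw [thresholdConst_of_lt hMN, inv_inv] at hc'
      rw [coeff_perturbedPoly]
      by_cases hkM : k = M
      · subst hkM
        rw [dif_pos hMN, if_pos rfl]
        linarith
      · rw [if_neg hkM, add_zero]
        split_ifs
        exacts [(hc _).le, le_rfl]
    · refine posSemidef_map_aeval_of_threshold hρ.le N M hNM c hc c' ?_ A hA
        fun i j => mem_closedBall_zero_iff.1 (hAI i j)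
      have hT := thresholdConst_nonneg hNM hc hρ.le
      have h1 := mul_le_mul_of_nonneg_right hc' hT
      have h2 : (thresholdConst c M ρ)⁻¹ * thresholdConst c M ρ ≤ 1 := inv_mul_le_one
      linarith
  tfae_finish
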